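/- Let $m\ge 1$, $q=2^m$, $F=\mathrm{GF}(q)$, let $\mathrm{Tr}$ be the trace of $F$ over $\mathrm{GF}(2)$, and for $a\in F\setminus\{0\}$ let $K(a)=\sum_{x\in F\setminus\{0\}}(-1)^{\mathrm{Tr}(ax+1/x)}$. For $b,c\in F$ let $\mu_2(b,c)$ be the number of solutions of the system $$x+y+z+u=1,\qquad u^2+xy+xz+xu+yz+yu+zu=b^2,\qquad x^3+y^3+z^3+u^3=c$$ in pairwise distinct elements $x,y,z,u$ of $F$, where solutions that differ only by a permutation of $x,y,z$ are counted once. (The system is symmetric in $x,y,z$.) Put $k_1=b^2+c+1$ and $k_2=b^2+b+c+\sqrt c$, where $\sqrt c$ is the unique square root of $c$ in $F$, and suppose that $k_1k_2\ne 0$. (1) If $m$ is odd and $\mathrm{Tr}(c)=1$, or $m$ is even and $\mathrm{Tr}(c)=0$, then $$\mu_2(b,c)=\tfrac16\bigl(q-8+(-1)^{\mathrm{Tr}(b)}(K(k_1k_2)-3)\bigr).$$ (2) If $m$ is odd and $\mathrm{Tr}(c)=0$, or $m$ is even and $\mathrm{Tr}(c)=1$, then $$\mu_2(b,c)=\tfrac16\bigl(q-2-(-1)^{\mathrm{Tr}(b)}(K(k_1k_2)+3)\bigr).$$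 -/

import Mathlib

namespace Goethals

variable {F : Type*} [Field F]

/-- The sign `(-1) ^ Tr a`, with `Tr` the absolute trace of `F` over `GF(2)`. -/
noncomputable def traceSign [Algebra (ZMod 2) F] (a : F) : ℤ :=
  (-1) ^ (Algebra.trace (ZMod 2) F a).val

/-- The Kloosterman sum `K(a) = ∑_{x ≠ 0} (-1) ^ Tr(a x + 1 / x)`; it is used for `a ≠ 0` only. -/
noncomputable def kloosterman [Fintype F] [DecidableEq F] [Algebra (ZMod 2) F] (a : F) : ℤ :=
  ∑ x : F with x ≠ 0, traceSign (a * x + 1 / x)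

/-- `x, y, z, u` are pairwise distinct and solve the system with parameters `b, c`. -/
def IsSolution (b c x y z u : F) : Prop :=
  (x ≠ y ∧ x ≠ z ∧ x ≠ u ∧ y ≠ z ∧ y ≠ u ∧ z ≠ u) ∧
  x + y + z + u = 1 ∧
  u ^ 2 + x * y + x * z + x * u + y * z + y * u + z * u = b ^ 2 ∧
  x ^ 3 + y ^ 3 + z ^ 3 + u ^ 3 = c

/-- The solutions `(x, y, z, u)`, where two solutions that differ only by a permutation of
`x, y, z` (in which the system is symmetric) are identified: a solution is recorded as the
unordered triple `{x, y, z}` together with `u`. -/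
def solutions [DecidableEq F] (b c : F) : Set (Finset F × F) :=
  {p | ∃ x y z u : F, IsSolution b c x y z u ∧ p = ({x, y, z}, u)}

/-- The number of solutions, up to permutation of `x, y, z`. -/
noncomputable def mu₂ [DecidableEq F] (b c : F) : ℕ := (solutions b c).ncard

/-- The unique square root of `c` in a finite field of characteristic two. -/
noncomputable def sqrt₂ [Finite F] [CharP F 2] (c : F) : F := (frobeniusEquiv F 2).symm c

theorem sqrt₂_sq [Finite F] [CharP F 2] (c : F) : sqrt₂ c ^ 2 = c :=
  frobeniusEquiv_symm_pow_p F 2 c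

def k₁ (b c : F) : F := b ^ 2 + c + 1

noncomputable def k₂ [Finite F] [CharP F 2] (b c : F) : F := b ^ 2 + b + c + sqrt₂ c

end Goethals

namespace Goethals

/-! ### Trace character and Artin–Schreier equations. -/

section TraceSign

variable {F : Type*} [Field F] [Algebra (ZMod 2) F]

/-! Write χ for `traceSign` and s = b + √c, so that k₁ = (s + 1)², k₂ = s(s + 1), and k₁k₂ ≠ 0 means
s ≠ 0, 1. For a solution, the pair sums σ = y + z, t = x + z and t + σ = x + y are the roots of a
cubic. Eliminating u² + u between its two coefficients fixes t(t + σ) in terms of σ and s alone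
(`isSolution_iff`). Given σ, there remain one quadratic in t and one in u, whose root counts have
the form 1 + χ (`card_quadratic`).

Summing the product over σ, partial fractions and χ(a²) = χ(a) leave only simple poles at σ = 0 and
σ = 1 (`sum_completions`). One-pole sums are elementary; the two-pole sum is a Kloosterman sum
(`sum_traceSign_div_add_div`). Each unordered solution is counted 6 times. -/

theorem traceSign_add (a b : F) : traceSign (a + b) = traceSign a * traceSign b := by
  have key : ∀ s t : ZMod 2, (-1 : ℤ) ^ (s + t).val = (-1) ^ s.val * (-1) ^ t.val := by decide
  simp only [traceSign, map_add, key]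

theorem traceSign_zero : traceSign (0 : F) = 1 := by
  simp [traceSign]

theorem traceSign_mul_self (a : F) : traceSign a * traceSign a = 1 := by
  simp [traceSign, ← mul_pow]

theorem traceSign_eq_of_trace_eq_zero {a : F} (h : Algebra.trace (ZMod 2) F a = 0) :
    traceSign a = 1 := by
  simp [traceSign, h]

theorem traceSign_eq_of_trace_eq_one {a : F} (h : Algebra.trace (ZMod 2) F a = 1) :
    traceSign a = -1 := by
  simp [traceSign, h, ZMod.val_one]

variable [Finite F]

theorem traceSign_one {m : ℕ} (hF : Nat.card F = 2 ^ m) : traceSign (1 : F) = (-1) ^ m := by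
  have hm : Module.finrank (ZMod 2) F = m := by
    have h := Module.natCard_eq_pow_finrank (K := ZMod 2) (V := F)
    rw [hF, Nat.card_zmod] at h
    exact (Nat.pow_right_injective le_rfl h).symm
  have h1 : Algebra.trace (ZMod 2) F 1 = (m : ZMod 2) := by
    simpa [hm] using Algebra.trace_algebraMap (R := ZMod 2) (S := F) 1
  rcases Nat.even_or_odd m with h | h
  · rw [h.neg_one_pow, traceSign_eq_of_trace_eq_zero (h1.trans (ZMod.natCast_eq_zero_iff_even.2 h))]
  · rw [h.neg_one_pow, traceSign_eq_of_trace_eq_one (h1.trans (ZMod.natCast_eq_one_iff_odd.2 h))]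

variable [CharP F 2]

theorem trace_sq (a : F) : Algebra.trace (ZMod 2) F (a ^ 2) = Algebra.trace (ZMod 2) F a := by
  have := Fintype.ofFinite F
  simpa [ZMod.card] using
    Algebra.trace_eq_of_algEquiv (FiniteField.frobeniusAlgEquiv (ZMod 2) F 2) a

theorem traceSign_sq (a : F) : traceSign (a ^ 2) = traceSign a := by
  rw [traceSign, trace_sq, traceSign]

/-- An element of trace zero has the form `x ^ 2 + x`. -/
theorem exists_sq_add_self_eq {a : F} (h : Algebra.trace (ZMod 2) F a = 0) :
    ∃ x : F, x ^ 2 + x = a := by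
  let φ : F →ₗ[ZMod 2] F := (FiniteField.frobeniusAlgEquiv (ZMod 2) F 2).toLinearMap + LinearMap.id
  have hφ : ∀ x, φ x = x ^ 2 + x := fun x => by
    simp [φ, ZMod.card]
  have hker : Module.finrank (ZMod 2) (LinearMap.ker φ) ≤ 1 := by
    refine finrank_le_one (⟨1, by simp [hφ, CharTwo.add_self_eq_zero]⟩) fun w => ?_
    have hw : w.1 ^ 2 + w.1 = 0 := by rw [← hφ]; exact w.2
    have : w.1 * (w.1 + 1) = 0 := by linear_combination hw
    rcases mul_eq_zero.1 this with h0 | h1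
    · exact ⟨0, by ext; simp [h0]⟩
    · exact ⟨1, by ext; simp [CharTwo.add_eq_zero.1 h1]⟩
  -- The range lies in the trace-zero hyperplane; as the kernel is at most a line, the dimensions
  -- agree.
  have hle : LinearMap.range φ ≤ LinearMap.ker (Algebra.trace (ZMod 2) F) := by
    rintro _ ⟨x, rfl⟩
    rw [LinearMap.mem_ker, hφ, map_add, trace_sq, CharTwo.add_self_eq_zero]
  have h1 := LinearMap.finrank_range_add_finrank_ker φ
  have h2 := LinearMap.finrank_range_add_finrank_ker (Algebra.trace (ZMod 2) F)
  rw [LinearMap.range_eq_top.2 (Algebra.trace_surjective (ZMod 2) F), finrank_top,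
    Module.finrank_self] at h2
  have heq := Submodule.eq_of_le_of_finrank_le hle (by omega)
  have : a ∈ LinearMap.range φ := heq ▸ h
  obtain ⟨x, hx⟩ := this
  exact ⟨x, by rw [← hφ, hx]⟩

end TraceSign

/-! ### Complete character sums and quadratic equations. -/

section Sums

variable {F : Type*} [Field F] [Fintype F] [Algebra (ZMod 2) F]

theorem sum_traceSign : ∑ x : F, traceSign x = 0 := by
  obtain ⟨y, hy⟩ := Algebra.trace_surjective (ZMod 2) F 1
  have h : ∑ x : F, traceSign x = -∑ x : F, traceSign x := by
    rw [← Finset.sum_neg_distrib]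
    refine Fintype.sum_equiv (Equiv.addRight y) _ _ fun x => ?_
    simp [traceSign_add, traceSign_eq_of_trace_eq_one hy]
  omega

variable [DecidableEq F]

theorem sum_traceSign_div {a : F} (ha : a ≠ 0) : ∑ x : F with x ≠ 0, traceSign (a / x) = -1 := by
  have h := sum_traceSign (F := F)
  rw [← Finset.sum_filter_add_sum_filter_not _ (· ≠ 0)] at h
  have h0 : ({x : F | ¬ x ≠ 0} : Finset F) = {0} := by ext; simp
  rw [h0, Finset.sum_singleton, traceSign_zero] at h
  have : ∑ x : F with x ≠ 0, traceSign (a / x) = ∑ x : F with x ≠ 0, traceSign x := by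
    refine Finset.sum_nbij' (a / ·) (a / ·) ?_ ?_ ?_ ?_ ?_ <;> simp +contextual [ha]
  omega

/-- The Kloosterman sum with two coefficients depends only on their product. -/
theorem sum_traceSign_mul_add_div {a : F} (ha : a ≠ 0) (b : F) :
    ∑ x : F with x ≠ 0, traceSign (a / x + b * x) = kloosterman (a * b) := by
  refine Finset.sum_nbij' (· / a) (a * ·) ?_ ?_ ?_ ?_ ?_ <;> simp +contextual [ha]
  · intro x _; field_simp
  · intro x hx; congr 1; field_simp; ring

variable [CharP F 2]

/-- The number of solutions of a quadratic equation in characteristic two. -/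
theorem card_quadratic {s : F} (hs : s ≠ 0) (p : F) :
    (({t : F | t * (t + s) = p} : Finset F).card : ℤ) = 1 + traceSign (p / s ^ 2) := by
  by_cases h : Algebra.trace (ZMod 2) F (p / s ^ 2) = 0
  · obtain ⟨x, hx⟩ := exists_sq_add_self_eq h
    have hp : p = s * x * (s * x + s) := by
      rw [eq_div_iff (pow_ne_zero 2 hs)] at hx
      linear_combination -hx
    have : ({t : F | t * (t + s) = p} : Finset F) = {s * x, s * x + s} := by
      ext t
      simp only [Finset.mem_filter, Finset.mem_univ, true_and, Finset.mem_insert,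
        Finset.mem_singleton]
      constructor
      · intro ht
        have : (t + s * x) * (t + (s * x + s)) = 0 := by grind
        exact (mul_eq_zero.1 this).imp CharTwo.add_eq_zero.1 CharTwo.add_eq_zero.1
      · rintro (rfl | rfl)
        · exact hp.symm
        · grind
    rw [this, Finset.card_pair (by simpa using hs), traceSign_eq_of_trace_eq_zero h]; rfl
  · have h1 : Algebra.trace (ZMod 2) F (p / s ^ 2) = 1 := by
      revert h; generalize Algebra.trace (ZMod 2) F (p / s ^ 2) = z; revert z; decide
    have : ({t : F | t * (t + s) = p} : Finset F) = ∅ := by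
      refine Finset.filter_eq_empty_iff.2 fun t _ ht => h ?_
      have : p / s ^ 2 = (t / s) ^ 2 + t / s := by rw [← ht]; field_simp
      rw [this, map_add, trace_sq, CharTwo.add_self_eq_zero]
    rw [this, traceSign_eq_of_trace_eq_one h1]; rfl

end Sums


/-! ### Sums over F without 0 and 1. -/

section PuncturedSums

variable {F : Type*} [Field F] [Fintype F] [DecidableEq F]

theorem sum_ne_zero_ne_one (f : F → ℤ) :
    ∑ x : F with x ≠ 0 ∧ x ≠ 1, f x = ∑ x : F with x ≠ 0, f x - f 1 := by
  have h : ({x : F | x ≠ 0 ∧ x ≠ 1} : Finset F) = ({x : F | x ≠ 0} : Finset F).erase 1 := by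
    ext; simp [and_comm]
  rw [h, eq_sub_iff_add_eq, Finset.sum_erase_add _ _ (by simp)]

theorem card_ne_zero_ne_one :
    (({x : F | x ≠ 0 ∧ x ≠ 1} : Finset F).card : ℤ) = Fintype.card F - 2 := by
  have h : ({x : F | x ≠ 0 ∧ x ≠ 1} : Finset F) = Finset.univ \ {0, 1} := by
    ext; simp
  have h2 : ({0, 1} : Finset F).card = 2 := Finset.card_pair zero_ne_one
  have h3 := Finset.card_le_univ ({0, 1} : Finset F)
  rw [h, Finset.card_sdiff_of_subset (Finset.subset_univ _), h2, Finset.card_univ]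
  omega

variable [Algebra (ZMod 2) F]

theorem sum_traceSign_div_punctured {a : F} (ha : a ≠ 0) :
    ∑ x : F with x ≠ 0 ∧ x ≠ 1, traceSign (a / x) = -1 - traceSign a := by
  rw [sum_ne_zero_ne_one (fun x => traceSign (a / x)), sum_traceSign_div ha, div_one]

variable [CharP F 2]

theorem sum_traceSign_div_add_one {a : F} (ha : a ≠ 0) :
    ∑ x : F with x ≠ 0 ∧ x ≠ 1, traceSign (a / (x + 1)) = -1 - traceSign a := by
  rw [← sum_traceSign_div_punctured ha]
  refine Finset.sum_nbij' (· + 1) (· + 1) ?_ ?_ ?_ ?_ ?_ <;>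
    simp +contextual [CharTwo.add_eq_zero, CharTwo.add_cancel_right]

/-- The involution w = x / (x + 1) gives 1/x = 1 + 1/w and 1/(x + 1) = 1 + w, moving the pole at 1
to infinity. The missing w = 1 contributes χ(a + b)² = 1. -/
theorem sum_traceSign_div_add_div {a : F} (ha : a ≠ 0) (b : F) :
    ∑ x : F with x ≠ 0 ∧ x ≠ 1, traceSign (a / x + b / (x + 1)) =
      traceSign (a + b) * kloosterman (a * b) - 1 := by
  have hinv : ∀ x : F, x ≠ 1 → x / (x + 1) / (x / (x + 1) + 1) = x := fun x hx => by
    have h1 : x + 1 ≠ 0 := fun h => hx (CharTwo.add_eq_zero.1 h)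
    have h2 : x / (x + 1) + 1 = 1 / (x + 1) := by
      field_simp; grind
    rw [h2]; field_simp
  have hmem : ∀ x : F, x ≠ 0 ∧ x ≠ 1 → x / (x + 1) ≠ 0 ∧ x / (x + 1) ≠ 1 := fun x ⟨h0, hx⟩ => by
    have h1 : x + 1 ≠ 0 := fun h => hx (CharTwo.add_eq_zero.1 h)
    refine ⟨div_ne_zero h0 h1, fun h => ?_⟩
    rw [div_eq_one_iff_eq h1] at h
    simp at h
  have h : ∑ x : F with x ≠ 0 ∧ x ≠ 1, traceSign (a / x + b / (x + 1)) =
      ∑ w : F with w ≠ 0 ∧ w ≠ 1, traceSign (a + b) * traceSign (a / w + b * w) := by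
    refine Finset.sum_nbij' (fun x => x / (x + 1)) (fun x => x / (x + 1)) ?_ ?_ ?_ ?_ ?_
    · simpa using fun x h0 h1 => hmem x ⟨h0, h1⟩
    · simpa using fun x h0 h1 => hmem x ⟨h0, h1⟩
    · simpa using fun x _ h1 => hinv x h1
    · simpa using fun x _ h1 => hinv x h1
    · intro x hx
      obtain ⟨h0, hx⟩ : x ≠ 0 ∧ x ≠ 1 := by simpa using hx
      have h1 : x + 1 ≠ 0 := fun h => hx (CharTwo.add_eq_zero.1 h)
      rw [← traceSign_add]
      congr 1
      field_simp
      grind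
  rw [h, ← Finset.mul_sum, sum_ne_zero_ne_one (fun w => traceSign (a / w + b * w)),
    sum_traceSign_mul_add_div ha, div_one, mul_one, mul_sub, traceSign_mul_self]

/-- The sum over the roots `σ` of the resolvent cubics; each summand is the number of ways to
complete `σ` to a solution. -/
theorem sum_completions {s : F} (h0 : s ≠ 0) (h1 : s ≠ 1) (e : F) :
    ∑ σ : F with σ ≠ 0 ∧ σ ≠ 1,
      (1 + traceSign ((σ ^ 2 + s ^ 2) / (σ + 1) / σ ^ 2)) *
        (1 + traceSign (σ * ((σ ^ 2 + s ^ 2) / (σ + 1)) + e)) =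
      Fintype.card F - 3 - traceSign e +
        traceSign (1 + s) * kloosterman ((1 + s ^ 2) * (s ^ 2 + s)) -
        3 * (traceSign e * traceSign (1 + s)) := by
  have hs1 : s + 1 ≠ 0 := fun h => h1 (CharTwo.add_eq_zero.1 h)
  have hα : s ^ 2 + s ≠ 0 := by
    rw [show s ^ 2 + s = s * (s + 1) by ring]; exact mul_ne_zero h0 hs1
  have hβ : 1 + s ^ 2 ≠ 0 := by
    rw [show 1 + s ^ 2 = (s + 1) ^ 2 by grind]; exact pow_ne_zero 2 hs1
  have hχα : traceSign (s ^ 2 + s) = 1 := by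
    rw [traceSign_add, traceSign_sq, traceSign_mul_self]
  have hχβ : traceSign (1 + s ^ 2) = traceSign (1 + s) := by
    rw [traceSign_add, traceSign_sq, traceSign_add]
  have hpt : ∀ σ ∈ ({σ : F | σ ≠ 0 ∧ σ ≠ 1} : Finset F),
      (1 + traceSign ((σ ^ 2 + s ^ 2) / (σ + 1) / σ ^ 2)) *
        (1 + traceSign (σ * ((σ ^ 2 + s ^ 2) / (σ + 1)) + e)) =
      1 + traceSign ((s ^ 2 + s) / σ + (1 + s ^ 2) / (σ + 1)) +
        traceSign e * traceSign (1 + s) * traceSign ((1 + s ^ 2) / (σ + 1)) +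
        traceSign e * traceSign (1 + s) * traceSign ((s ^ 2 + s) / σ) := by
    intro σ hσ
    obtain ⟨hσ0, hσ1⟩ : σ ≠ 0 ∧ σ ≠ 1 := by simpa using hσ
    have hσ2 : σ + 1 ≠ 0 := fun h => hσ1 (CharTwo.add_eq_zero.1 h)
    -- Partial fractions; under χ the double pole (s/σ)² counts as s/σ.
    have e1 : (σ ^ 2 + s ^ 2) / (σ + 1) / σ ^ 2 =
        (s / σ) ^ 2 + (s ^ 2 / σ + (1 + s ^ 2) / (σ + 1)) := by
      field_simp; grind
    -- The polynomial part is arranged as v² + v, on which χ is 1, plus a constant.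
    have e2 : σ * ((σ ^ 2 + s ^ 2) / (σ + 1)) =
        (σ + 1) ^ 2 + (σ + 1) + ((1 + s ^ 2) + (1 + s ^ 2) / (σ + 1)) := by
      field_simp; grind
    have t1 : traceSign ((σ ^ 2 + s ^ 2) / (σ + 1) / σ ^ 2) =
        traceSign ((s ^ 2 + s) / σ) * traceSign ((1 + s ^ 2) / (σ + 1)) := by
      rw [e1, add_div (s ^ 2) s σ]
      simp only [traceSign_add, traceSign_sq]
      ring
    have t2 : traceSign (σ * ((σ ^ 2 + s ^ 2) / (σ + 1)) + e) =
        traceSign (1 + s) * traceSign ((1 + s ^ 2) / (σ + 1)) * traceSign e := by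
      rw [e2, traceSign_add _ e, traceSign_add _ ((1 + s ^ 2) + _), traceSign_add ((σ + 1) ^ 2),
        traceSign_sq, traceSign_mul_self, traceSign_add (1 + s ^ 2), hχβ, one_mul]
    rw [t1, t2, traceSign_add (_ / σ)]
    -- In the cross term the pole at σ = 1 occurs twice and cancels.
    linear_combination traceSign ((s ^ 2 + s) / σ) * traceSign (1 + s) * traceSign e *
      traceSign_mul_self ((1 + s ^ 2) / (σ + 1))
  rw [Finset.sum_congr rfl hpt]
  simp only [Finset.sum_add_distrib, ← Finset.mul_sum]
  rw [sum_traceSign_div_add_div hα, sum_traceSign_div_add_one hβ, sum_traceSign_div_punctured hα,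
    Finset.sum_const, nsmul_eq_mul, card_ne_zero_ne_one, hχα, hχβ, mul_comm (s ^ 2 + s),
    show s ^ 2 + s + (1 + s ^ 2) = 1 + s by grind]
  linear_combination -traceSign e * traceSign_mul_self (1 + s)

end PuncturedSums

/-! ### From solutions to the character sum. -/

section Counting

variable {F : Type*} [Field F]

theorem IsSolution.swap_left {b c x y z u : F} (h : IsSolution b c x y z u) :
    IsSolution b c y x z u := by
  obtain ⟨⟨h1, h2, h3, h4, h5, h6⟩, e1, e2, e3⟩ := h
  exact ⟨⟨h1.symm, h4, h5, h2, h3, h6⟩, by linear_combination e1, by linear_combination e2,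
    by linear_combination e3⟩

theorem IsSolution.swap_right {b c x y z u : F} (h : IsSolution b c x y z u) :
    IsSolution b c x z y u := by
  obtain ⟨⟨h1, h2, h3, h4, h5, h6⟩, e1, e2, e3⟩ := h
  exact ⟨⟨h2, h1, h3, h4.symm, h6, h5⟩, by linear_combination e1, by linear_combination e2,
    by linear_combination e3⟩

/-- The shifted coordinates `σ = x + 1 + u` and `t = y + 1 + u` turn the system into two
quadratic equations over `σ`. -/
theorem isSolution_iff [CharP F 2] {b c s : F} (hs : s ^ 2 = b ^ 2 + c) (h1 : s ≠ 1)
    (σ t u : F) :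
    IsSolution b c (σ + 1 + u) (t + 1 + u) (t + σ + 1 + u) u ↔
      (σ ≠ 0 ∧ σ ≠ 1 ∧ σ ≠ s) ∧ t * (t + σ) = (σ ^ 2 + s ^ 2) / (σ + 1) ∧
        u * (u + 1) = σ * ((σ ^ 2 + s ^ 2) / (σ + 1)) + (c + 1) := by
  have hsq : ∀ a : F, a ^ 2 = s ^ 2 → a = s := fun a h => CharTwo.sq_inj.1 h
  have hs1 : s ^ 2 ≠ 1 := fun h => h1 (hsq 1 (by rw [h, one_pow])).symm
  constructor
  · rintro ⟨⟨hxy, hxz, hxu, hyz, hyu, hzu⟩, -, e2, e3⟩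
    -- Coefficients of the cubic with roots σ, t, t + σ; their sum is free of u and gives `hπ`.
    have hA : σ ^ 2 + t * (t + σ) = u * (u + 1) + 1 + b ^ 2 := by grind
    have hB : σ * (t * (t + σ)) = u * (u + 1) + (c + 1) := by grind
    have hπ : t * (t + σ) * (σ + 1) = σ ^ 2 + s ^ 2 := by grind
    have h1σ : σ ≠ 1 := by grind
    have h1σ' : σ + 1 ≠ 0 := fun h => h1σ (CharTwo.add_eq_zero.1 h)
    have hdiv : t * (t + σ) = (σ ^ 2 + s ^ 2) / (σ + 1) := (eq_div_iff h1σ').2 hπ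
    refine ⟨⟨by grind, h1σ, ?_⟩, hdiv, by rw [← hdiv]; grind⟩
    rintro rfl
    rw [CharTwo.add_self_eq_zero, zero_div] at hdiv
    rcases mul_eq_zero.1 hdiv with h | h
    · exact hxz (by rw [h]; ring)
    · exact hxy (by rw [CharTwo.add_eq_zero.1 h])
  · rintro ⟨⟨hσ0, hσ1, hσs⟩, ht, hu⟩
    rw [← ht] at hu
    have hσ1' : σ + 1 ≠ 0 := fun h => hσ1 (CharTwo.add_eq_zero.1 h)
    rw [eq_div_iff hσ1'] at ht
    have hσs' : σ ^ 2 ≠ s ^ 2 := fun h => hσs (hsq σ h)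
    -- One of x, y, z equals u only if σ, t or t + σ is 1, and t = 1 or t + σ = 1 would force s² =
    -- 1.
    refine ⟨⟨?_, ?_, ?_, ?_, ?_, ?_⟩, ?_, ?_, ?_⟩ <;> grind

variable [Fintype F]

open Classical in
/-- The ordered solutions of the system. -/
noncomputable def orderedSolutions (b c : F) : Finset (F × F × F × F) :=
  {p | IsSolution b c p.1 p.2.1 p.2.2.1 p.2.2.2}

theorem mem_orderedSolutions {b c x y z u : F} :
    (x, y, z, u) ∈ orderedSolutions b c ↔ IsSolution b c x y z u := by
  simp [orderedSolutions]

variable [DecidableEq F]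

theorem card_orderedSolutions (b c : F) : (orderedSolutions b c).card = 6 * mu₂ b c := by
  let f : F × F × F × F → Finset F × F := fun p => ({p.1, p.2.1, p.2.2.1}, p.2.2.2)
  have himage : solutions b c = ((orderedSolutions b c).image f : Finset (Finset F × F)) := by
    ext p
    simp only [solutions, Set.mem_ofPred_eq, Finset.coe_image, Set.mem_image, Finset.mem_coe,
      Prod.exists, mem_orderedSolutions, f]
    grind
  rw [mu₂, himage, Set.ncard_coe_finset, mul_comm,
    Finset.card_eq_sum_card_image f (orderedSolutions b c), Finset.sum_const_nat]
  intro p hp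
  obtain ⟨⟨x, y, z, u⟩, hsol, rfl⟩ := Finset.mem_image.1 hp
  rw [mem_orderedSolutions] at hsol
  obtain ⟨hxy, hxz, -, hyz, -, -⟩ := hsol.1
  have hfib : {q ∈ orderedSolutions b c | f q = f (x, y, z, u)} =
      {(x, y, z, u), (x, z, y, u), (y, x, z, u), (y, z, x, u), (z, x, y, u), (z, y, x, u)} := by
    ext ⟨x', y', z', u'⟩
    simp only [Finset.mem_filter, mem_orderedSolutions, Finset.mem_insert, Finset.mem_singleton,
      Prod.mk.injEq, f]
    constructor
    · rintro ⟨h', hset, rfl⟩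
      obtain ⟨hxy', hxz', -, hyz', -, -⟩ := h'.1
      have hx : x' ∈ ({x, y, z} : Finset F) := hset ▸ by simp
      have hy : y' ∈ ({x, y, z} : Finset F) := hset ▸ by simp
      have hz : z' ∈ ({x, y, z} : Finset F) := hset ▸ by simp
      simp only [Finset.mem_insert, Finset.mem_singleton] at hx hy hz
      clear hset hp h' hsol
      grind
    · rintro (⟨rfl, rfl, rfl, rfl⟩ | ⟨rfl, rfl, rfl, rfl⟩ | ⟨rfl, rfl, rfl, rfl⟩ |
        ⟨rfl, rfl, rfl, rfl⟩ | ⟨rfl, rfl, rfl, rfl⟩ | ⟨rfl, rfl, rfl, rfl⟩)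
      · exact ⟨hsol, rfl, rfl⟩
      · exact ⟨hsol.swap_right, by ext; simp; tauto, rfl⟩
      · exact ⟨hsol.swap_left, by ext; simp; tauto, rfl⟩
      · exact ⟨hsol.swap_left.swap_right, by ext; simp; tauto, rfl⟩
      · exact ⟨hsol.swap_right.swap_left, by ext; simp; tauto, rfl⟩
      · exact ⟨hsol.swap_right.swap_left.swap_right, by ext; simp; tauto, rfl⟩
  rw [hfib]
  simp [hxy, hxz, hyz, hxy.symm, hxz.symm, hyz.symm, Finset.card_insert_of_notMem]

variable [CharP F 2] [Algebra (ZMod 2) F]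

theorem card_orderedSolutions_eq_sum {b c s : F} (hs : s ^ 2 = b ^ 2 + c) (h1 : s ≠ 1) :
    ((orderedSolutions b c).card : ℤ) = ∑ σ : F with σ ≠ 0 ∧ σ ≠ 1 ∧ σ ≠ s,
      (1 + traceSign ((σ ^ 2 + s ^ 2) / (σ + 1) / σ ^ 2)) *
        (1 + traceSign (σ * ((σ ^ 2 + s ^ 2) / (σ + 1)) + (c + 1))) := by
  have hcard : (orderedSolutions b c).card =
      (({σ : F | σ ≠ 0 ∧ σ ≠ 1 ∧ σ ≠ s} : Finset F).sigma fun σ =>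
        ({t : F | t * (t + σ) = (σ ^ 2 + s ^ 2) / (σ + 1)} : Finset F) ×ˢ
        ({u : F | u * (u + 1) = σ * ((σ ^ 2 + s ^ 2) / (σ + 1)) + (c + 1)} : Finset F)).card := by
    symm
    refine Finset.card_nbij
      (fun p => (p.1 + 1 + p.2.2, p.2.1 + 1 + p.2.2, p.2.1 + p.1 + 1 + p.2.2, p.2.2)) ?_ ?_ ?_
    · rintro ⟨σ, t, u⟩ h
      rw [Finset.mem_coe, mem_orderedSolutions, isSolution_iff hs h1]
      simpa using h
    · rintro ⟨σ, t, u⟩ - ⟨σ', t', u'⟩ - h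
      simp only [Prod.mk.injEq] at h
      obtain ⟨e1, e2, -, rfl⟩ := h
      simp only [add_left_inj] at e1 e2
      rw [e1, e2]
    · rintro ⟨x, y, z, u⟩ h
      rw [Finset.mem_coe, mem_orderedSolutions] at h
      have hsum := h.2.1
      have ex : x = (x + 1 + u) + 1 + u := by grind
      have ey : y = (y + 1 + u) + 1 + u := by grind
      have ez : z = (y + 1 + u) + (x + 1 + u) + 1 + u := by grind
      refine ⟨⟨x + 1 + u, y + 1 + u, u⟩, ?_, ?_⟩
      · rw [ex, ey, ez, isSolution_iff hs h1] at h
        simpa using h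
      · simp only [← ex, ← ey, ← ez]
  rw [hcard, Finset.card_sigma]
  push_cast [Finset.card_product]
  refine Finset.sum_congr rfl fun σ hσ => ?_
  have h0 : σ ≠ 0 := by simp at hσ; exact hσ.1
  rw [card_quadratic h0, card_quadratic one_ne_zero]
  simp

/-- The degenerate σ = s (where x = y or x = z) is in the full sum but gives no solution; its term
2(1 + χ(c + 1)) is removed. -/
theorem six_mul_mu₂ {b c s : F} (hs : s ^ 2 = b ^ 2 + c) (h0 : s ≠ 0) (h1 : s ≠ 1) :
    6 * (mu₂ b c : ℤ) = Fintype.card F - 5 - 3 * traceSign (c + 1) +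
        traceSign (1 + s) * kloosterman ((1 + s ^ 2) * (s ^ 2 + s)) -
        3 * (traceSign (c + 1) * traceSign (1 + s)) := by
  have h := sum_completions h0 h1 (c + 1)
  have herase : ({σ : F | σ ≠ 0 ∧ σ ≠ 1 ∧ σ ≠ s} : Finset F) =
      ({σ : F | σ ≠ 0 ∧ σ ≠ 1} : Finset F).erase s := by
    ext; simp; tauto
  rw [← Finset.sum_erase_add _ _ (a := s) (by simp [h0, h1]), ← herase,
    ← card_orderedSolutions_eq_sum hs h1, card_orderedSolutions, CharTwo.add_self_eq_zero,
    zero_div, zero_div, mul_zero, zero_add, traceSign_zero] at h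
  push_cast at h
  linear_combination h

end Counting

end Goethals

theorem theorem1 {F : Type*} [Field F] [Fintype F] [DecidableEq F] [CharP F 2]
    [Algebra (ZMod 2) F] (m : ℕ) (hF : Fintype.card F = 2 ^ m) (b c : F)
    (hk : Goethals.k₁ b c * Goethals.k₂ b c ≠ 0) :
    ((Odd m ∧ Algebra.trace (ZMod 2) F c = 1) ∨ (Even m ∧ Algebra.trace (ZMod 2) F c = 0) →
      (Goethals.mu₂ b c : ℚ) =
        (1 / 6) * ((2 : ℚ) ^ m - 8 + (Goethals.traceSign b : ℚ) *
          ((Goethals.kloosterman (Goethals.k₁ b c * Goethals.k₂ b c) : ℚ) - 3))) ∧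
    ((Odd m ∧ Algebra.trace (ZMod 2) F c = 0) ∨ (Even m ∧ Algebra.trace (ZMod 2) F c = 1) →
      (Goethals.mu₂ b c : ℚ) =
        (1 / 6) * ((2 : ℚ) ^ m - 2 - (Goethals.traceSign b : ℚ) *
          ((Goethals.kloosterman (Goethals.k₁ b c * Goethals.k₂ b c) : ℚ) + 3))) := by
  open Goethals in
  obtain ⟨s, hs⟩ : ∃ s : F, s = b + sqrt₂ c := ⟨_, rfl⟩
  have hs2 : s ^ 2 = b ^ 2 + c := by rw [hs, CharTwo.add_sq, sqrt₂_sq]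
  have hk₁ : k₁ b c = 1 + s ^ 2 := by rw [k₁, hs2]; ring
  have hk₂ : k₂ b c = s ^ 2 + s := by rw [k₂, hs2, hs]; ring
  have h0 : s ≠ 0 := fun h => hk (by rw [hk₂, h]; ring)
  have h1 : s ≠ 1 := fun h => hk (by rw [hk₁, h, one_pow, CharTwo.add_self_eq_zero, zero_mul])
  have hone := traceSign_one (F := F) (m := m) (by rw [Nat.card_eq_fintype_card, hF])
  have hχs : traceSign (1 + s) = traceSign (c + 1) * traceSign b := by
    rw [hs, ← add_assoc, traceSign_add, ← traceSign_sq (sqrt₂ c), sqrt₂_sq, traceSign_add,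
      traceSign_add c]
    ring
  have hmain : 6 * (mu₂ b c : ℚ) = 2 ^ m - 5 - 3 * traceSign (c + 1) +
      traceSign (c + 1) * traceSign b * kloosterman (k₁ b c * k₂ b c) -
      3 * (traceSign (c + 1) * (traceSign (c + 1) * traceSign b)) := by
    have h := six_mul_mu₂ hs2 h0 h1
    rw [hF, hχs, ← hk₁, ← hk₂] at h
    exact_mod_cast h
  constructor
  · intro h
    -- χ(c + 1) = (-1)^(Tr c + m), so the two cases of the theorem are its two signs.
    have hc : traceSign (c + 1) = 1 := by
      rw [traceSign_add, hone]
      rcases h with ⟨hm, ht⟩ | ⟨hm, ht⟩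
      · rw [traceSign_eq_of_trace_eq_one ht, hm.neg_one_pow]; rfl
      · rw [traceSign_eq_of_trace_eq_zero ht, hm.neg_one_pow]; rfl
    rw [hc] at hmain
    push_cast at hmain
    linear_combination hmain / 6
  · intro h
    have hc : traceSign (c + 1) = -1 := by
      rw [traceSign_add, hone]
      rcases h with ⟨hm, ht⟩ | ⟨hm, ht⟩
      · rw [traceSign_eq_of_trace_eq_zero ht, hm.neg_one_pow]; rfl
      · rw [traceSign_eq_of_trace_eq_one ht, hm.neg_one_pow]; rfl
    rw [hc] at hmain
    push_cast at hmain
    linear_combination hmain / 6
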